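/- Let $f:\{1,2,3,\dots\}\to\mathbb{R}$ be an additive arithmetic function, i.e. $f(1)=0$ and $f(mn)=f(m)+f(n)$ whenever $\gcd(m,n)=1$. Suppose that for every $t\in\mathbb{R}$ $$\sum_{n=1}^{\infty}\frac{\left|(e^{itf}*\mu)(n)\right|}{n}<\infty,$$ where $e^{itf}$ denotes the function $n\mapsto e^{itf(n)}$, $\mu$ is the Möbius function and $*$ is Dirichlet convolution, $(g*h)(n)=\sum_{d\mid n}g(d)h(n/d)$. Then $f$ has a limit distribution: there is a probability measure $P$ on $\mathbb{R}$, with distribution function $F(y)=P((-\infty,y])$, such that $$F_n(y)=\frac{1}{n}\,\#\{m\in\{1,\dots,n\}: f(m)\le y\}\longrightarrow F(y)\qquad(n\to\infty)$$ at every point $y$ at which $F$ is continuous. Moreover, its characteristic function $\varphi_f(t)=\int_{\mathbb{R}}e^{itx}\,dP(x)$ is given, for every $t\in\mathbb{R}$, by $$\varphi_f(t)=\prod_{p}\left(1-\frac1p\right)\sum_{\alpha\ge 0}\frac{e^{itf(p^{\alpha})}}{p^{\alpha}},$$ where the product runs over all primes $p$, the inner series converge absolutely, and the finite partial products converge to $\varphi_f(t)$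 unconditionally (independently of the order of the primes). -/

import Mathlib

namespace AdditiveArith

/-- A real arithmetic function is additive if `f 1 = 0` and `f (m * n) = f m + f n`
for coprime positive integers `m`, `n`. -/
def IsAdditive (f : ArithmeticFunction ℝ) : Prop :=
  f 1 = 0 ∧ ∀ m n : ℕ, 0 < m → 0 < n → m.Coprime n → f (m * n) = f m + f n

/-- The complex arithmetic function `n ↦ e^{i t f(n)}` on the positive integers
(arithmetic functions take the value `0` at `0` by convention). -/
noncomputable def expArith (f : ArithmeticFunction ℝ) (t : ℝ) : ArithmeticFunction ℂ where
  toFun n := if n = 0 then 0 else Complex.exp (Complex.I * (t : ℂ) * (f n : ℂ))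
  map_zero' := if_pos rfl

/-- The Dirichlet convolution `e^{i t f} * μ`, where `μ` is the Möbius function. -/
noncomputable def expConvMoebius (f : ArithmeticFunction ℝ) (t : ℝ) : ArithmeticFunction ℂ :=
  expArith f t * ((ArithmeticFunction.moebius : ArithmeticFunction ℤ) : ArithmeticFunction ℂ)

/-- The distribution function `F_n(y) = #{m ∈ {1, …, n} : f(m) ≤ y} / n` of `f` on
`{1, …, n}` with the uniform probability. -/
noncomputable def distFun (f : ArithmeticFunction ℝ) (n : ℕ) (y : ℝ) : ℝ :=
  (Set.ncard {m : ℕ | 1 ≤ m ∧ m ≤ n ∧ f m ≤ y} : ℝ) / (n : ℝ)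

/-- `f` has the limit distribution `P`: `P` is a probability measure on the line, and the
distribution functions `F_n` converge weakly to the distribution function of `P`, that is,
at each of its continuity points. -/
def HasLimitDistribution (f : ArithmeticFunction ℝ) (P : MeasureTheory.Measure ℝ) : Prop :=
  MeasureTheory.IsProbabilityMeasure P ∧
    ∀ y : ℝ, ContinuousAt (fun z : ℝ => ProbabilityTheory.cdf P z) y →
      Filter.Tendsto (fun n : ℕ => distFun f n y) Filter.atTop
        (nhds (ProbabilityTheory.cdf P y))

end AdditiveArith

/-!
Since `e^{itf} = (e^{itf} * μ) * 1`, Wintner's mean value theorem shows that the characteristic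
functions of the empirical laws of `f` converge to `M(t) = ∑ (e^{itf} * μ)(n) / n`, and
multiplicativity of `e^{itf} * μ` factors `M(t)` as the Euler product. By Lévy's theorem it remains
to prove that `M` is continuous at `0`. Put `S(t) = ∑ |(e^{itf} * μ)(q)| / q`, summed over the prime
powers `q > 1`; the Euler product gives `|M(t) - 1| ≤ e^{S(t)} - 1`. As
`|(e^{itf} * μ)(p^{k+1})| = |e^{it(f(p^{k+1}) - f(p^k))} - 1|` is a seminorm on the additive group
`ℝ`, so is `S`. A pointwise convergent series of continuous seminorms on a Baire group is continuous
at `0`, so `S(t) → S(0) = 0` as `t → 0`.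
-/

open Filter Finset MeasureTheory ProbabilityTheory Topology
open scoped NNReal

namespace AdditiveArith

section Seminorms

variable {G ι : Type*} [AddGroup G] [TopologicalSpace G] [SeparatelyContinuousAdd G] [BaireSpace G]
  [Countable ι] {p : ι → AddGroupSeminorm G}

/- By Baire, some tail is small on a neighborhood of some `s`; as `t = -s + (s + t)`, subadditivity
moves this neighborhood to `0` at the cost of a factor `2`. -/
theorem exists_finset_eventually_forall_sum_addGroupSeminorm_le (hp : ∀ i, Continuous (p i))
    (hs : ∀ t, Summable fun i ↦ p i t) {ε : ℝ} (hε : 0 < ε) :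
    ∃ F : Finset ι, ∀ᶠ t in 𝓝 (0 : G), ∀ H : Finset ι, Disjoint H F → ∑ i ∈ H, p i t ≤ ε := by
  let E (F : Finset ι) : Set G := {t | ∀ H : Finset ι, Disjoint H F → ∑ i ∈ H, p i t ≤ ε / 2}
  have isClosed_E (F : Finset ι) : IsClosed (E F) := by
    simp only [E, Set.ofPred_forall]
    exact isClosed_iInter fun H ↦ isClosed_iInter fun _ ↦
      isClosed_le (continuous_finsetSum _ fun i _ ↦ hp i) continuous_const
  have iUnion_E : ⋃ F, E F = Set.univ := by
    refine Set.eq_univ_of_forall fun t ↦ Set.mem_iUnion.2 ?_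
    obtain ⟨F, hF⟩ := summable_iff_vanishing_norm.1 (hs t) (ε / 2) (half_pos hε)
    exact ⟨F, fun H hH ↦ (Real.le_norm_self _).trans (hF H hH).le⟩
  obtain ⟨F, s, hsF⟩ := nonempty_interior_of_iUnion_of_closed isClosed_E iUnion_E
  have add_mem_E : ∀ᶠ t in 𝓝 (0 : G), s + t ∈ E F :=
    (SeparatelyContinuousAdd.continuous_const_add.tendsto' 0 s (add_zero s)).eventually
      (mem_interior_iff_mem_nhds.1 hsF)
  refine ⟨F, add_mem_E.mono fun t ht H hH ↦ ?_⟩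
  calc ∑ i ∈ H, p i t ≤ ∑ i ∈ H, (p i s + p i (s + t)) := sum_le_sum fun i _ ↦ by
        simpa using map_add_le_add (p i) (-s) (s + t)
    _ ≤ ε / 2 + ε / 2 := by
        rw [sum_add_distrib]
        exact add_le_add (interior_subset hsF H hH) (ht H hH)
    _ = ε := add_halves ε

theorem continuousAt_zero_tsum_addGroupSeminorm (hp : ∀ i, Continuous (p i))
    (hs : ∀ t, Summable fun i ↦ p i t) : ContinuousAt (fun t ↦ ∑' i, p i t) 0 := by
  refine continuousAt_of_locally_uniform_approx_of_continuousAt fun u hu ↦ ?_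
  obtain ⟨ε, hε, hεu⟩ := Metric.mem_uniformity_dist.1 hu
  obtain ⟨F, hF⟩ :=
    exists_finset_eventually_forall_sum_addGroupSeminorm_le hp hs (half_pos hε)
  refine ⟨_, hF, fun t ↦ ∑ i ∈ F, p i t,
    (continuous_finsetSum F fun i _ ↦ hp i).continuousAt, fun t ht ↦ hεu ?_⟩
  have tail_le : ∑' i : {i // i ∉ F}, p i t ≤ ε / 2 := by
    refine Summable.tsum_le_of_sum_le ((hs t).subtype (· ∉ F)) fun H ↦ ?_
    calc ∑ i ∈ H, p i t = ∑ i ∈ H.map (.subtype _), p i t := by rw [sum_map]; rfl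
      _ ≤ ε / 2 := ht _ (disjoint_left.2 fun i hi ↦ property_of_mem_map_subtype H hi)
  have tail_nonneg : 0 ≤ ∑' i : {i // i ∉ F}, p i t := tsum_nonneg fun i ↦ apply_nonneg (p i) t
  rw [Real.dist_eq, ← (hs t).sum_add_tsum_subtype_compl F, add_sub_cancel_left,
    abs_of_nonneg tail_nonneg]
  exact tail_le.trans_lt (half_lt_self hε)

end Seminorms

section EulerProduct

variable {R : Type*} [NormedCommRing R] [NormOneClass R]

theorem norm_sub_one_le_of_hasProd_one_add {ι : Type*} {c : ι → R} {P : R}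
    (h : HasProd (fun i ↦ 1 + c i) P) (hc : Summable fun i ↦ ‖c i‖) :
    ‖P - 1‖ ≤ Real.exp (∑' i, ‖c i‖) - 1 := by
  refine le_of_tendsto (h.sub_const 1).norm (.of_forall fun s ↦ ?_)
  grw [s.norm_prod_one_add_sub_one_le c, hc.sum_le_tsum s fun i _ ↦ norm_nonneg _]

theorem norm_tsum_sub_one_le_of_multiplicative [CompleteSpace R] {g : ℕ → R} (hg0 : g 0 = 0)
    (hg1 : g 1 = 1) (hmul : ∀ {m n : ℕ}, m.Coprime n → g (m * n) = g m * g n)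
    (hs : Summable fun n ↦ ‖g n‖) :
    ‖∑' n, g n - 1‖ ≤ Real.exp (∑' q : Nat.Primes × ℕ, ‖g ((q.1 : ℕ) ^ (q.2 + 1))‖) - 1 := by
  have hpow : Summable fun q : Nat.Primes × ℕ ↦ ‖g ((q.1 : ℕ) ^ (q.2 + 1))‖ :=
    hs.comp_injective (Subtype.val_injective.comp Nat.Primes.prodNatEquiv.injective)
  have euler : HasProd (fun p : Nat.Primes ↦ 1 + ∑' k, g ((p : ℕ) ^ (k + 1))) (∑' n, g n) := by
    convert EulerProduct.eulerProduct_hasProd hg1 hmul hs hg0 using 2 with p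
    have hp : Summable fun k ↦ g ((p : ℕ) ^ k) :=
      hs.of_norm.comp_injective (Nat.pow_right_injective p.2.two_le)
    rw [hp.tsum_eq_zero_add, pow_zero, hg1]
  have norm_le (p : Nat.Primes) :
      ‖∑' k, g ((p : ℕ) ^ (k + 1))‖ ≤ ∑' k, ‖g ((p : ℕ) ^ (k + 1))‖ :=
    norm_tsum_le_tsum_norm (hpow.prod_factor p)
  have hsum : Summable fun p : Nat.Primes ↦ ‖∑' k, g ((p : ℕ) ^ (k + 1))‖ :=
    hpow.prod.of_nonneg_of_le (fun _ ↦ norm_nonneg _) norm_le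
  grw [norm_sub_one_le_of_hasProd_one_add euler hsum, hsum.tsum_le_tsum norm_le hpow.prod,
    hpow.tsum_prod]

end EulerProduct

section Wintner

open scoped ArithmeticFunction.zeta

theorem tendsto_natDiv_div_atTop (n : ℕ) :
    Tendsto (fun N : ℕ ↦ ((N / n : ℕ) : ℝ) / N) atTop (𝓝 (n : ℝ)⁻¹) := by
  refine ((tendsto_nat_floor_mul_div_atTop (R := ℝ) (a := (n : ℝ)⁻¹) (by positivity)).comp
    tendsto_natCast_atTop_atTop).congr fun N ↦ ?_
  rw [Function.comp_apply, inv_mul_eq_div, Nat.floor_div_eq_div]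

variable {𝕜 : Type*} [RCLike 𝕜]

/-- **Wintner's mean value theorem**. -/
theorem tendsto_average_mul_zeta {h : ArithmeticFunction 𝕜}
    (hs : Summable fun n : ℕ ↦ ‖h n‖ / (n : ℝ)) :
    Tendsto (fun N : ℕ ↦ (∑ n ∈ Ioc 0 N, (h * (ζ : ArithmeticFunction 𝕜)) n) / (N : 𝕜)) atTop
      (𝓝 (∑' n : ℕ, h n / n)) := by
  have average_eq (N : ℕ) : (∑ n ∈ Ioc 0 N, (h * (ζ : ArithmeticFunction 𝕜)) n) / (N : 𝕜) =
      ∑' n : ℕ, h n * (((N / n : ℕ) : ℝ) / N : ℝ) := by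
    rw [ArithmeticFunction.sum_Ioc_mul_zeta_eq_sum, sum_div, tsum_eq_sum (s := Ioc 0 N)]
    · exact sum_congr rfl fun n _ ↦ by push_cast; rw [mul_div_assoc]
    · intro n hn
      obtain rfl | hNn : n = 0 ∨ N < n := by simp only [mem_Ioc] at hn; lia
      · simp
      · simp [Nat.div_eq_of_lt hNn]
  simp_rw [average_eq]
  refine tendsto_tsum_of_dominated_convergence hs (fun n ↦ ?_) (.of_forall fun N n ↦ ?_)
  · rw [div_eq_mul_inv, ← RCLike.ofReal_natCast, ← RCLike.ofReal_inv]
    exact (((RCLike.continuous_ofReal (K := 𝕜)).tendsto _).comp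
      (tendsto_natDiv_div_atTop n)).const_mul (h n)
  · rw [norm_mul, RCLike.norm_ofReal, abs_of_nonneg (by positivity), div_eq_mul_inv ‖h n‖]
    gcongr
    grw [Nat.cast_div_le, div_right_comm]
    simpa using div_le_div_of_nonneg_right (div_self_le_one (N : ℝ)) n.cast_nonneg

end Wintner

section LocalFactor

open scoped ArithmeticFunction.Moebius

theorem mul_moebius_prime_pow_succ {R : Type*} [Ring R] (g : ArithmeticFunction R) {p : ℕ}
    (hp : p.Prime) (k : ℕ) :
    (g * (μ : ArithmeticFunction R)) (p ^ (k + 1)) = g (p ^ (k + 1)) - g (p ^ k) := by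
  set h := g * (μ : ArithmeticFunction R) with h_def
  have sum_eq (k : ℕ) : ∑ i ∈ range (k + 1), h (p ^ i) = g (p ^ k) := by
    rw [← Nat.sum_divisors_prime_pow hp, ← ArithmeticFunction.coe_mul_zeta_apply, h_def, mul_assoc,
      ArithmeticFunction.coe_moebius_mul_coe_zeta, mul_one]
  rw [← sum_eq, ← sum_eq, sum_range_succ, add_sub_cancel_left]

theorem tsum_mul_moebius_prime_pow_div {𝕜 : Type*} [NormedField 𝕜] (g : ArithmeticFunction 𝕜)
    {p : ℕ} (hp : p.Prime) (hg : Summable fun k : ℕ ↦ g (p ^ k) / (p : 𝕜) ^ k) :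
    ∑' k : ℕ, (g * (μ : ArithmeticFunction 𝕜)) (p ^ k) / (p : 𝕜) ^ k =
      (1 - 1 / (p : 𝕜)) * ∑' k : ℕ, g (p ^ k) / (p : 𝕜) ^ k := by
  set h := g * (μ : ArithmeticFunction 𝕜) with h_def
  have h_one : h 1 = g 1 := by simp [h_def]
  have h_succ (k : ℕ) : h (p ^ (k + 1)) / (p : 𝕜) ^ (k + 1) =
      g (p ^ (k + 1)) / (p : 𝕜) ^ (k + 1) - 1 / (p : 𝕜) * (g (p ^ k) / (p : 𝕜) ^ k) := by
    rw [h_def, mul_moebius_prime_pow_succ g hp, sub_div, div_mul_div_comm, one_mul, ← pow_succ']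
  have hg_succ := (summable_nat_add_iff 1).2 hg
  have h_summable : Summable fun k : ℕ ↦ h (p ^ k) / (p : 𝕜) ^ k := by
    refine (summable_nat_add_iff 1).1 ?_
    simpa only [h_succ] using hg_succ.sub (hg.mul_left _)
  rw [h_summable.tsum_eq_zero_add]
  simp_rw [h_succ]
  rw [hg_succ.tsum_sub (hg.mul_left _), tsum_mul_left, sub_mul, one_mul, hg.tsum_eq_zero_add,
    pow_zero, h_one]
  ring

end LocalFactor

section WeakConvergence

/-- **Lévy's continuity theorem** with existence of the limit. -/
theorem exists_tendsto_of_tendsto_charFun {E : Type*} [NormedAddCommGroup E]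
    [InnerProductSpace ℝ E] [FiniteDimensional ℝ E] [MeasurableSpace E] [BorelSpace E]
    {μ : ℕ → ProbabilityMeasure E} {φ : E → ℂ} (hφ : ContinuousAt φ 0)
    (h : ∀ t, Tendsto (fun n ↦ charFun (μ n : Measure E) t) atTop (𝓝 (φ t))) :
    ∃ P : ProbabilityMeasure E, Tendsto μ atTop (𝓝 P) ∧ ∀ t, charFun (P : Measure E) t = φ t := by
  have compact : IsCompact (closure (Set.range μ)) :=
    isCompact_closure_of_isTightMeasureSet <| by
      simpa [Set.range] using isTightMeasureSet_of_tendsto_charFun hφ h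
  obtain ⟨P, -, hP⟩ := compact.exists_mapClusterPt (f := atTop) (u := μ) <|
    tendsto_principal.2 <| .of_forall fun n ↦ subset_closure (Set.mem_range_self n)
  have charFun_eq (t : E) : charFun (P : Measure E) t = φ t := by
    have continuous_charFun :
        Continuous fun Q : ProbabilityMeasure E ↦ charFun (Q : Measure E) t := by
      simp_rw [charFun_eq_integral_innerProbChar]
      exact continuous_iff_continuousAt.2 fun Q ↦
        (ProbabilityMeasure.tendsto_iff_forall_integral_rclike_tendsto ℂ).1 tendsto_id _
    have := (hP.continuousAt_comp continuous_charFun.continuousAt).clusterPt.mono (h t)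
    exact eq_of_nhds_neBot this
  refine ⟨P, ProbabilityMeasure.tendsto_of_tendsto_charFun fun t ↦ ?_, charFun_eq⟩
  rw [charFun_eq]
  exact h t

theorem tendsto_cdf_of_tendsto {ι : Type*} {l : Filter ι} {μ : ι → ProbabilityMeasure ℝ}
    {P : ProbabilityMeasure ℝ} (h : Tendsto μ l (𝓝 P)) {y : ℝ}
    (hy : ContinuousAt (cdf (P : Measure ℝ)) y) :
    Tendsto (fun i ↦ cdf (μ i : Measure ℝ) y) l (𝓝 (cdf (P : Measure ℝ) y)) := by
  have frontier_null : (P : Measure ℝ) (frontier (Set.Iic y)) = 0 := by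
    rw [frontier_Iic, ← measure_cdf (P : Measure ℝ), StieltjesFunction.measure_singleton,
      hy.continuousWithinAt.leftLim_eq, sub_self, ENNReal.ofReal_zero]
  simp_rw [cdf_eq_real]
  exact (ENNReal.tendsto_toReal (measure_ne_top _ _)).comp
    (ProbabilityMeasure.tendsto_measure_of_null_frontier_of_tendsto' h frontier_null)

end WeakConvergence

section ExpArith

theorem norm_exp_I_mul_mul (t x : ℝ) : ‖Complex.exp (Complex.I * t * x)‖ = 1 := by
  rw [mul_assoc, ← Complex.ofReal_mul, Complex.norm_exp_I_mul_ofReal]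

/-- The group seminorm `t ↦ ‖e^{itx} - 1‖` on `ℝ`, i.e. the chordal distance from `e^{itx}` to `1`
on the unit circle. -/
noncomputable def expSeminorm (x : ℝ) : AddGroupSeminorm ℝ where
  toFun t := ‖Complex.exp (Complex.I * t * x) - 1‖
  map_zero' := by simp
  add_le' s t := by
    calc ‖Complex.exp (Complex.I * (s + t : ℝ) * x) - 1‖
        = ‖(Complex.exp (Complex.I * s * x) - 1) +
            Complex.exp (Complex.I * s * x) * (Complex.exp (Complex.I * t * x) - 1)‖ := by
          rw [Complex.ofReal_add, mul_add, add_mul, Complex.exp_add]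
          ring_nf
      _ ≤ _ := by grw [norm_add_le, norm_mul, norm_exp_I_mul_mul, one_mul]
  neg' t := by
    calc ‖Complex.exp (Complex.I * (-t : ℝ) * x) - 1‖
        = ‖Complex.exp (Complex.I * t * x) * (Complex.exp (Complex.I * (-t : ℝ) * x) - 1)‖ := by
          rw [norm_mul, norm_exp_I_mul_mul, one_mul]
      _ = ‖1 - Complex.exp (Complex.I * t * x)‖ := by
          rw [mul_sub_one, ← Complex.exp_add, ← add_mul, ← mul_add, ← Complex.ofReal_add,
            add_neg_cancel, Complex.ofReal_zero, mul_zero, zero_mul, Complex.exp_zero]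
      _ = _ := norm_sub_rev _ _

theorem expSeminorm_apply (x t : ℝ) : expSeminorm x t = ‖Complex.exp (Complex.I * t * x) - 1‖ :=
  rfl

theorem continuous_expSeminorm (x : ℝ) : Continuous (expSeminorm x) := by
  change Continuous fun t : ℝ ↦ ‖Complex.exp (Complex.I * t * x) - 1‖
  fun_prop

theorem summable_exp_div_pow (f : ArithmeticFunction ℝ) (t : ℝ) {p : ℕ} (hp : 1 < p) :
    Summable fun a : ℕ ↦ Complex.exp (Complex.I * t * f (p ^ a)) / (p : ℂ) ^ a := by
  refine .of_norm_bounded (summable_geometric_of_lt_one (r := (p : ℝ)⁻¹) (by positivity)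
    (inv_lt_one_of_one_lt₀ (by exact_mod_cast hp))) fun a ↦ ?_
  rw [norm_div, norm_exp_I_mul_mul, norm_pow, Complex.norm_natCast, one_div, inv_pow]

variable {f : ArithmeticFunction ℝ}

theorem expArith_of_ne_zero {t : ℝ} {n : ℕ} (hn : n ≠ 0) :
    expArith f t n = Complex.exp (Complex.I * t * f n) := if_neg hn

theorem isMultiplicative_expArith (hf : IsAdditive f) (t : ℝ) :
    (expArith f t).IsMultiplicative := by
  refine ArithmeticFunction.IsMultiplicative.iff_ne_zero.2 ⟨?_, fun {m n} hm hn hmn ↦ ?_⟩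
  · simp [expArith_of_ne_zero, hf.1]
  · rw [expArith_of_ne_zero hm, expArith_of_ne_zero hn, expArith_of_ne_zero (mul_ne_zero hm hn),
      hf.2 m n (Nat.pos_of_ne_zero hm) (Nat.pos_of_ne_zero hn) hmn, ← Complex.exp_add,
      Complex.ofReal_add, mul_add]

end ExpArith

section EmpiricalLaw

theorem integral_uniformOn_finset {Ω E : Type*} [MeasurableSpace Ω] [MeasurableSingletonClass Ω]
    [NormedAddCommGroup E] [NormedSpace ℝ E] [CompleteSpace E] (s : Finset Ω) (g : Ω → E) :
    ∫ x, g x ∂uniformOn (s : Set Ω) = (#s : ℝ)⁻¹ • ∑ x ∈ s, g x := by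
  have integrable : IntegrableOn g s Measure.count := by
    rw [← Set.biUnion_of_singleton (s : Set Ω), integrableOn_finite_biUnion s.finite_toSet]
    simp
  rw [uniformOn, ProbabilityTheory.cond, integral_smul_measure, setIntegral_finset _ integrable]
  simp

variable (f : ArithmeticFunction ℝ) (n : ℕ)

/-- The law of `f` on `{1, …, n}` with the uniform probability. -/
noncomputable def empiricalLaw : Measure ℝ :=
  (uniformOn (Ioc 0 n : Set ℕ)).map f

theorem isProbabilityMeasure_empiricalLaw [NeZero n] : IsProbabilityMeasure (empiricalLaw f n) := by
  have : IsProbabilityMeasure (uniformOn (Ioc 0 n : Set ℕ)) :=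
    isProbabilityMeasure_uniformOn (finite_toSet _) ⟨n, by simp [NeZero.pos n]⟩
  exact Measure.isProbabilityMeasure_map .of_discrete

theorem empiricalLaw_real_Iic (y : ℝ) : (empiricalLaw f n).real (Set.Iic y) = distFun f n y := by
  classical
  have inter_eq :
      (Ioc 0 n : Set ℕ) ∩ f ⁻¹' Set.Iic y = ((Ioc 0 n).filter (f · ≤ y) : Finset ℕ) := by
    ext; simp
  have set_eq : {m : ℕ | 1 ≤ m ∧ m ≤ n ∧ f m ≤ y} = ((Ioc 0 n).filter (f · ≤ y) : Finset ℕ) := by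
    ext; simp [Nat.succ_le_iff, and_assoc]
  rw [empiricalLaw, map_measureReal_apply .of_discrete measurableSet_Iic, measureReal_def,
    ← uniformOn_inter_self (finite_toSet _), inter_eq, uniformOn_apply_finset, distFun, set_eq,
    Set.ncard_coe_finset, inter_eq_right.2 (filter_subset _ _)]
  simp

theorem charFun_empiricalLaw (t : ℝ) :
    charFun (empiricalLaw f n) t = (∑ m ∈ Ioc 0 n, expArith f t m) / (n : ℂ) := by
  rw [charFun_apply_real, empiricalLaw, integral_map .of_discrete (by fun_prop),
    integral_uniformOn_finset, Nat.card_Ioc, tsub_zero, Complex.real_smul, Complex.ofReal_inv,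
    Complex.ofReal_natCast, div_eq_inv_mul]
  congr 1
  refine sum_congr rfl fun m hm ↦ ?_
  rw [expArith_of_ne_zero (mem_Ioc.1 hm).1.ne', mul_comm, mul_assoc]

theorem exists_hasLimitDistribution_of_tendsto_average {φ : ℝ → ℂ} (hφ : ContinuousAt φ 0)
    (h : ∀ t, Tendsto (fun n : ℕ ↦ (∑ m ∈ Ioc 0 n, expArith f t m) / (n : ℂ)) atTop (𝓝 (φ t))) :
    ∃ P : Measure ℝ, HasLimitDistribution f P ∧ ∀ t, charFun P t = φ t := by
  let μ (n : ℕ) : ProbabilityMeasure ℝ :=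
    ⟨empiricalLaw f (n + 1), isProbabilityMeasure_empiricalLaw f (n + 1)⟩
  have tendsto_charFun (t : ℝ) : Tendsto (fun n ↦ charFun (μ n : Measure ℝ) t) atTop (𝓝 (φ t)) :=
    ((h t).comp (tendsto_add_atTop_nat 1)).congr fun n ↦ (charFun_empiricalLaw f (n + 1) t).symm
  obtain ⟨P, hP, charFun_eq⟩ := exists_tendsto_of_tendsto_charFun hφ tendsto_charFun
  refine ⟨P, ⟨inferInstance, fun y hy ↦ (tendsto_add_atTop_iff_nat 1).1 ?_⟩, charFun_eq⟩
  refine (tendsto_cdf_of_tendsto hP hy).congr fun n ↦ ?_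
  rw [cdf_eq_real]
  exact empiricalLaw_real_Iic f (n + 1) y

end EmpiricalLaw

section MeanValue

open scoped ArithmeticFunction.zeta

variable {f : ArithmeticFunction ℝ} {t : ℝ}

theorem isMultiplicative_expConvMoebius (hf : IsAdditive f) (t : ℝ) :
    (expConvMoebius f t).IsMultiplicative :=
  (isMultiplicative_expArith hf t).mul ArithmeticFunction.isMultiplicative_moebius.intCast

theorem expConvMoebius_mul_zeta (f : ArithmeticFunction ℝ) (t : ℝ) :
    expConvMoebius f t * (ζ : ArithmeticFunction ℂ) = expArith f t := by
  rw [expConvMoebius, mul_assoc, ArithmeticFunction.coe_moebius_mul_coe_zeta, mul_one]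

/-- The mean value of `e^{itf}`, defined through its series `∑ (e^{itf} * μ)(n) / n`. -/
noncomputable def meanValue (f : ArithmeticFunction ℝ) (t : ℝ) : ℂ :=
  ∑' n : ℕ, expConvMoebius f t n / n

theorem tendsto_average_expArith (hs : Summable fun n : ℕ ↦ ‖expConvMoebius f t n‖ / (n : ℝ)) :
    Tendsto (fun n : ℕ ↦ (∑ m ∈ Ioc 0 n, expArith f t m) / (n : ℂ)) atTop
      (𝓝 (meanValue f t)) := by
  simpa only [expConvMoebius_mul_zeta, meanValue] using tendsto_average_mul_zeta hs

theorem expConvMoebius_mul_div_mul (hf : IsAdditive f) (t : ℝ) {m n : ℕ} (h : m.Coprime n) :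
    expConvMoebius f t (m * n) / ((m * n : ℕ) : ℂ) =
      expConvMoebius f t m / m * (expConvMoebius f t n / n) := by
  rw [(isMultiplicative_expConvMoebius hf t).2 h, Nat.cast_mul, mul_div_mul_comm]

theorem hasProd_meanValue (hf : IsAdditive f)
    (hs : Summable fun n : ℕ ↦ ‖expConvMoebius f t n‖ / (n : ℝ)) :
    HasProd (fun p : Nat.Primes ↦ (1 - 1 / ((p : ℕ) : ℂ)) *
      ∑' a : ℕ, Complex.exp (Complex.I * t * f ((p : ℕ) ^ a)) / ((p : ℕ) : ℂ) ^ a)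
      (meanValue f t) := by
  have euler := EulerProduct.eulerProduct_hasProd (f := fun n : ℕ ↦ expConvMoebius f t n / n)
    (by simp [(isMultiplicative_expConvMoebius hf t).1]) (expConvMoebius_mul_div_mul hf t)
    (by simpa using hs) (by simp)
  rw [meanValue]
  convert euler using 2 with p
  have expArith_pow (a : ℕ) : expArith f t ((p : ℕ) ^ a) =
      Complex.exp (Complex.I * t * f ((p : ℕ) ^ a)) :=
    expArith_of_ne_zero (pow_ne_zero a p.2.ne_zero)
  have local_factor := tsum_mul_moebius_prime_pow_div (expArith f t) p.2 <| by
    simpa only [expArith_pow] using summable_exp_div_pow f t p.2.one_lt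
  simpa only [expArith_pow, expConvMoebius, Nat.cast_pow] using local_factor.symm

theorem norm_expConvMoebius_prime_pow_succ (f : ArithmeticFunction ℝ) (t : ℝ) {p : ℕ}
    (hp : p.Prime) (k : ℕ) :
    ‖expConvMoebius f t (p ^ (k + 1))‖ = expSeminorm (f (p ^ (k + 1)) - f (p ^ k)) t := by
  have exp_eq : Complex.exp (Complex.I * t * f (p ^ (k + 1))) =
      Complex.exp (Complex.I * t * f (p ^ k)) *
        Complex.exp (Complex.I * t * ((f (p ^ (k + 1)) - f (p ^ k) : ℝ) : ℂ)) := by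
    rw [← Complex.exp_add]
    push_cast
    ring_nf
  rw [expConvMoebius, mul_moebius_prime_pow_succ _ hp,
    expArith_of_ne_zero (pow_ne_zero _ hp.ne_zero), expArith_of_ne_zero (pow_ne_zero _ hp.ne_zero),
    exp_eq, ← mul_sub_one, norm_mul, norm_exp_I_mul_mul, one_mul, expSeminorm_apply]

/-- The contribution `t ↦ ‖(e^{itf} * μ)(p^{k+1})‖ / p^{k+1}` of the prime power `p^{k+1}` to the
series defining the mean value, as a group seminorm in `t`; it is indexed by `(p, k)`. -/
noncomputable def primePowSeminorm (f : ArithmeticFunction ℝ) (q : Nat.Primes × ℕ) :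
    AddGroupSeminorm ℝ :=
  (((q.1 : ℕ) ^ (q.2 + 1) : ℕ) : ℝ≥0)⁻¹ •
    expSeminorm (f ((q.1 : ℕ) ^ (q.2 + 1)) - f ((q.1 : ℕ) ^ q.2))

theorem primePowSeminorm_apply (f : ArithmeticFunction ℝ) (q : Nat.Primes × ℕ) (t : ℝ) :
    primePowSeminorm f q t =
      ‖expConvMoebius f t ((q.1 : ℕ) ^ (q.2 + 1)) / (((q.1 : ℕ) ^ (q.2 + 1) : ℕ) : ℂ)‖ := by
  rw [norm_div, norm_expConvMoebius_prime_pow_succ f t q.1.2, Complex.norm_natCast, div_eq_inv_mul]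
  simp [primePowSeminorm, smul_apply, NNReal.smul_def]

theorem continuous_primePowSeminorm (f : ArithmeticFunction ℝ) (q : Nat.Primes × ℕ) :
    Continuous (primePowSeminorm f q) :=
  (continuous_expSeminorm _).const_smul _

theorem summable_primePowSeminorm (hs : Summable fun n : ℕ ↦ ‖expConvMoebius f t n‖ / (n : ℝ)) :
    Summable fun q ↦ primePowSeminorm f q t := by
  simp_rw [primePowSeminorm_apply]
  have hs' : Summable fun n : ℕ ↦ ‖expConvMoebius f t n / n‖ := by simpa using hs
  exact hs'.comp_injective (Subtype.val_injective.comp Nat.Primes.prodNatEquiv.injective)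

theorem norm_meanValue_sub_one_le (hf : IsAdditive f)
    (hs : Summable fun n : ℕ ↦ ‖expConvMoebius f t n‖ / (n : ℝ)) :
    ‖meanValue f t - 1‖ ≤ Real.exp (∑' q, primePowSeminorm f q t) - 1 := by
  simp_rw [primePowSeminorm_apply]
  exact norm_tsum_sub_one_le_of_multiplicative (g := fun n : ℕ ↦ expConvMoebius f t n / n)
    (by simp) (by simp [(isMultiplicative_expConvMoebius hf t).1]) (expConvMoebius_mul_div_mul hf t)
    (by simpa using hs)

theorem continuousAt_meanValue (hf : IsAdditive f)
    (hs : ∀ t : ℝ, Summable fun n : ℕ ↦ ‖expConvMoebius f t n‖ / (n : ℝ)) :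
    ContinuousAt (meanValue f) 0 := by
  have bound_tendsto :
      Tendsto (fun t ↦ Real.exp (∑' q, primePowSeminorm f q t) - 1) (𝓝 0) (𝓝 0) := by
    have := continuousAt_zero_tsum_addGroupSeminorm (continuous_primePowSeminorm f) fun t ↦
      summable_primePowSeminorm (hs t)
    simpa using this.rexp.tendsto.sub_const 1
  refine continuousAt_of_tendsto_nhds (y := 1) (tendsto_iff_norm_sub_tendsto_zero.2 ?_)
  exact squeeze_zero (fun _ ↦ norm_nonneg _) (fun t ↦ norm_meanValue_sub_one_le hf (hs t))
    bound_tendsto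

end MeanValue

end AdditiveArith

theorem mainTheorem1 (f : ArithmeticFunction ℝ) (hf : AdditiveArith.IsAdditive f)
    (hsum : ∀ t : ℝ, Summable fun n : ℕ => ‖AdditiveArith.expConvMoebius f t n‖ / (n : ℝ)) :
    ∃ P : MeasureTheory.Measure ℝ,
      AdditiveArith.HasLimitDistribution f P ∧
      ∀ t : ℝ,
        (∀ p : Nat.Primes, Summable fun a : ℕ =>
          Complex.exp (Complex.I * (t : ℂ) * (f ((p : ℕ) ^ a) : ℂ)) / ((p : ℕ) : ℂ) ^ a) ∧
        HasProd
          (fun p : Nat.Primes => (1 - 1 / ((p : ℕ) : ℂ)) *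
            ∑' a : ℕ, Complex.exp (Complex.I * (t : ℂ) * (f ((p : ℕ) ^ a) : ℂ)) /
              ((p : ℕ) : ℂ) ^ a)
          (MeasureTheory.charFun P t) := by
  obtain ⟨P, hP, charFun_eq⟩ := AdditiveArith.exists_hasLimitDistribution_of_tendsto_average f
    (AdditiveArith.continuousAt_meanValue hf hsum)
    fun t ↦ AdditiveArith.tendsto_average_expArith (hsum t)
  refine ⟨P, hP, fun t ↦ ⟨fun p ↦ AdditiveArith.summable_exp_div_pow f t p.2.one_lt, ?_⟩⟩
  rw [charFun_eq]
  exact AdditiveArith.hasProd_meanValue hf (hsum t)
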